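/- **Setting.** Let $n$ clients hold vectors $z_1,\dots,z_n\in\mathbb{R}^d$. A *$K$-round SecAgg-compatible protocol* $\mathcal{A}$ runs as follows. In round $t=1,\dots,K$ there is a finite abelian group $\mathcal{O}_t$ (for instance the additive group of a finite field); each client $i$ encodes $z_i$ as an element of $\mathcal{O}_t$ by a (possibly randomized, measurable) encoder, and the server learns only the sum $O_t\in\mathcal{O}_t$ of the $n$ messages. The group $\mathcal{O}_t$ and the encoders of round $t$ may depend on $O_1,\dots,O_{t-1}$; in particular $\mathcal{O}_1$ is fixed in advance. After $K$ rounds a (possibly randomized) decoder outputs $\mathcal{A}(z_1,\dots,z_n)\in\mathbb{R}^d$ as a function of $O_1,\dots,O_K$. The randomness of the protocol (which may be shared) is independent of the data. The total per-client communication is $\sum_{t=1}^K\log_2|\mathcal{O}_t|$ bits. For $G>0$ let $\mathcal{P}_2(d,G)$ be the set of probability distributions $\mathcal{D}$ on $\mathbb{R}^d$ with $\|z\|\le G$ for $\mathcal D$-almost every $z$, and let $\mu(\mathcal{D})$ be the mean of $\mathcal{D}$. The protocol is *unbiased* if $\mathbb{E}_{D\sim\mathcal{D}^n}[\mathcal{A}(D)]=\mu(\mathcal{D})$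 (with integrability) for all $\mathcal{D}\in\mathcal{P}_2(d,G)$. Put $$\alpha=\frac{G^2}{n}+\frac{G^2d\log(1/\delta)}{n^2\varepsilon^2},\qquad B(m)=\min\Big(d,\ \frac{m^2n^2\varepsilon^2}{\log(1/\delta)},\ m^2nd\Big).$$ **Theorem (interaction is necessary).** Let $K,d,n$ be integers with $K\ge0$, $d\ge1$, $n\ge2$, let $G,\varepsilon>0$ and $0<\delta<1$, and let $\mathcal{A}$ be a $K$-round unbiased SecAgg-compatible protocol. 1. If there are constants $C_1,C_2$ such that for every $\mathcal{D}\in\mathcal{P}_2(d,G)$, on $D\sim\mathcal{D}^n$, one has $\mathbb{E}\|\mathcal{A}(D)-\mu(\mathcal{D})\|^2\le C_1\min(\|\mu(\mathcal{D})\|^2,\alpha)$, and with probability $>\frac1n$ the total per-client communication is at most $C_2\,B(\|\mu(\mathcal{D})\|)$ bits, then $K\ge2$. 2. There is an absolute constant $c>0$ (independent of all the parameters and of $\mathcal{A}$) such that the same conclusion $K\ge 2$ holds under the following weaker hypotheses: for some constants $C_1\ge1$, $C_2$ and some $s<\frac{c}{C_1}B(1)$, for every $\mathcal{D}\in\mathcal{P}_2(d,G)$,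 on $D\sim\mathcal{D}^n$, one has $\mathbb{E}\|\mathcal{A}(D)-\mu(\mathcal{D})\|^2\le C_1\alpha$, and with probability $>\frac1n$ the total per-client communication is at most $C_2\,B(\|\mu(\mathcal{D})\|/G)+s$ bits. So one-round protocols cannot adapt their communication to the norm of the mean. -/

import Mathlib

open MeasureTheory
open scoped ENNReal

universe u

/-- A `K`-round protocol with secure aggregation for `n` clients holding vectors of `ℝ^d`, with all
randomness of the encoders and of the decoder carried by `Ω`, written as a protocol tree.

With no round left, the server decodes.  A round consists of a finite abelian group `O` over which
secure aggregation operates (for instance the additive group of a finite field), an encoder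
`enc i ω : ℝ^d → O` for each client `i`, and, for each value `o : O` of the aggregate
`∑ i, enc i ω (z i)` (all that the server sees of the messages), the rest of the protocol.
Hence the message space, the encoders and the decoder of a round may depend on the aggregates of the
earlier rounds, and the message space of the first round is fixed in advance. -/
inductive SecAggProtocol (Ω : Type u) [MeasurableSpace Ω] (n d : ℕ) : ℕ → Type (max u 1)
  | decode (U : Ω → EuclideanSpace ℝ (Fin d)) (hU : Measurable U) : SecAggProtocol Ω n d 0
  | round {K : ℕ} (O : Type) [AddCommGroup O] [Fintype O]
      (enc : Fin n → Ω → EuclideanSpace ℝ (Fin d) → O)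
      (henc : ∀ i o, MeasurableSet {p : Ω × EuclideanSpace ℝ (Fin d) | enc i p.1 p.2 = o})
      (next : O → SecAggProtocol Ω n d K) : SecAggProtocol Ω n d (K + 1)

namespace SecAggProtocol

variable {Ω : Type u} [MeasurableSpace Ω] {n d : ℕ}

/-- The estimate that the protocol outputs on the dataset `z`, with randomness `ω`. -/
def output : {K : ℕ} → SecAggProtocol Ω n d K → Ω → (Fin n → EuclideanSpace ℝ (Fin d)) →
    EuclideanSpace ℝ (Fin d)
  | _, decode U _, ω, _ => U ω
  | _, round _ enc _ next, ω, z => (next (∑ i, enc i ω (z i))).output ω z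

/-- The total per-client communication, in bits: the sum over the rounds of `log₂ |O|`. -/
noncomputable def bits : {K : ℕ} → SecAggProtocol Ω n d K → Ω →
    (Fin n → EuclideanSpace ℝ (Fin d)) → ℝ
  | _, decode _ _, _, _ => 0
  | _, round O enc _ next, ω, z =>
      Real.logb 2 (Fintype.card O) + (next (∑ i, enc i ω (z i))).bits ω z

end SecAggProtocol

/-- The probability distributions on `ℝ^d` supported in the ball of radius `G`. -/
def boundedDistributions (d : ℕ) (G : ℝ) : Set (Measure (EuclideanSpace ℝ (Fin d))) :=
  {D | IsProbabilityMeasure D ∧ ∀ᵐ z ∂D, ‖z‖ ≤ G}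

/-- The mean of a distribution. -/
noncomputable def distMean {d : ℕ} (D : Measure (EuclideanSpace ℝ (Fin d))) :
    EuclideanSpace ℝ (Fin d) := ∫ z, z ∂D

/-- The joint law of the randomness of the protocol and of `n` i.i.d. samples from `D`. -/
noncomputable def runLaw {Ω : Type u} [MeasurableSpace Ω] (P : Measure Ω) (n : ℕ) {d : ℕ}
    (D : Measure (EuclideanSpace ℝ (Fin d))) :
    Measure (Ω × (Fin n → EuclideanSpace ℝ (Fin d))) :=
  P.prod (Measure.pi fun _ => D)

/-- The error rate `G²/n + G² d log(1/δ) / (n² ε²)`. -/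
noncomputable def errorRate (d n : ℕ) (G ε δ : ℝ) : ℝ :=
  G ^ 2 / n + G ^ 2 * d * Real.log (1 / δ) / (n ^ 2 * ε ^ 2)

/-- The communication budget `min (d, m² n² ε² / log(1/δ), m² n d)` for a mean of norm `m`. -/
noncomputable def commBudget (d n : ℕ) (ε δ m : ℝ) : ℝ :=
  min (d : ℝ) (min (m ^ 2 * n ^ 2 * ε ^ 2 / Real.log (1 / δ)) (m ^ 2 * n * d))

namespace SecAggProtocol

variable {Ω : Type u} [MeasurableSpace Ω] {n d K : ℕ}

/-- The output is an unbiased estimate of the mean of every distribution bounded by `G`. -/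
def Unbiased (A : SecAggProtocol Ω n d K) (P : Measure Ω) (G : ℝ) : Prop :=
  ∀ D ∈ boundedDistributions d G,
    Integrable (fun x : Ω × (Fin n → EuclideanSpace ℝ (Fin d)) => A.output x.1 x.2)
      (runLaw P n D) ∧
    ∫ x, A.output x.1 x.2 ∂(runLaw P n D) = distMean D

/-- The mean squared error of the protocol on `n` i.i.d. samples from `D`. -/
noncomputable def mse (A : SecAggProtocol Ω n d K) (P : Measure Ω)
    (D : Measure (EuclideanSpace ℝ (Fin d))) : ℝ≥0∞ :=
  ∫⁻ x, ENNReal.ofReal (‖A.output x.1 x.2 - distMean D‖ ^ 2) ∂(runLaw P n D)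

/-- The probability that the total per-client communication on `n` i.i.d. samples from `D` is at
most `b` bits. -/
noncomputable def probBitsLE (A : SecAggProtocol Ω n d K) (P : Measure Ω)
    (D : Measure (EuclideanSpace ℝ (Fin d))) (b : ℝ) : ℝ :=
  (runLaw P n D).real {x | A.bits x.1 x.2 ≤ b}

end SecAggProtocol

/-!
At zero mean the budget vanishes, and a protocol with at most one round fixes its message space
before it sees anything, so its communication is bounded for *all* inputs by what is allowed at zero
mean. When all clients hold the same vector, such a protocol is an unbiased randomized quantizer
whose codebook has some size `N`, and an unbiased quantizer of the sign vectors of norm `G` has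
second moment at least `G² d / (2 log N)`.

The bound for quantizers is a union bound in exponential form. For a codeword `v` and a uniformly
random sign vector `σ`, sub-Gaussianity says that `exp (⟪v, σ⟫ - ‖v‖² / 2)` has mean at most `1`.
Hence, however the codeword `v` is selected among `N` candidates as a function of `σ`, the mean of
`⟪v, σ⟫ - ‖v‖² / 2` is at most `log N`. Rescaling the codebook and optimizing over the scale gives
`(𝔼 ⟪v, σ⟫)² ≤ 2 log N · 𝔼 ‖v‖²`, and unbiasedness determines the left-hand side.
-/

open scoped BigOperators RealInnerProductSpace

section SubGaussian

variable {S ι E : Type*} [Fintype S] [Fintype ι] [NormedAddCommGroup E] [InnerProductSpace ℝ E]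

lemma expect_select_le_log_card {F : ι → S → ℝ} (hF : ∀ o, 𝔼 s, Real.exp (F o s) ≤ 1)
    (q : S → ι) : 𝔼 s, F (q s) s ≤ Real.log (Fintype.card ι) := by
  rcases isEmpty_or_nonempty S with hS | hS
  · simpa using Real.log_natCast_nonneg (Fintype.card ι)
  have : Nonempty ι := hS.map q
  have hN : (0 : ℝ) < Fintype.card ι := by exact_mod_cast Fintype.card_pos
  -- The tangent line of `exp` at `log N`.
  have htangent (s : S) : F (q s) s ≤
      Real.log (Fintype.card ι) + (∑ o, Real.exp (F o s)) / Fintype.card ι - 1 := by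
    have hexp := Real.add_one_le_exp (F (q s) s - Real.log (Fintype.card ι))
    rw [Real.exp_sub, Real.exp_log hN] at hexp
    have hsum : Real.exp (F (q s) s) ≤ ∑ o, Real.exp (F o s) :=
      Finset.single_le_sum (f := fun o => Real.exp (F o s)) (fun _ _ => (Real.exp_pos _).le)
        (Finset.mem_univ (q s))
    have := div_le_div_of_nonneg_right hsum hN.le
    linarith
  calc 𝔼 s, F (q s) s
      ≤ 𝔼 s, (Real.log (Fintype.card ι) + (∑ o, Real.exp (F o s)) / Fintype.card ι - 1) := by
        gcongr with s
        exact htangent s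
    _ = Real.log (Fintype.card ι) + (∑ o, 𝔼 s, Real.exp (F o s)) / Fintype.card ι - 1 := by
        rw [Finset.expect_sub_distrib, Finset.expect_add_distrib, ← Finset.expect_div,
          Finset.expect_sum_comm, Fintype.expect_const, Fintype.expect_const]
    _ ≤ Real.log (Fintype.card ι) + (∑ _o : ι, 1) / Fintype.card ι - 1 := by
        gcongr with o
        exact hF o
    _ = Real.log (Fintype.card ι) := by simp [hN.ne']

/-- A finite family of vectors is sub-Gaussian if a uniformly random member of it is, with variance
proxy `1` in every direction. -/
def IsSubGaussianFamily (x : S → E) : Prop :=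
  ∀ v, 𝔼 s, Real.exp ⟪v, x s⟫ ≤ Real.exp (‖v‖ ^ 2 / 2)

namespace IsSubGaussianFamily

variable {x : S → E}

lemma expect_inner_sub_half_norm_sq_le (hx : IsSubGaussianFamily x) (V : ι → E) (q : S → ι) :
    𝔼 s, (⟪V (q s), x s⟫ - ‖V (q s)‖ ^ 2 / 2) ≤ Real.log (Fintype.card ι) := by
  refine expect_select_le_log_card (F := fun o s => ⟪V o, x s⟫ - ‖V o‖ ^ 2 / 2) (fun o => ?_) q
  simp_rw [Real.exp_sub, ← Finset.expect_div]
  exact div_le_one_of_le₀ (hx (V o)) (Real.exp_pos _).le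

variable {Ω : Type*} [MeasurableSpace Ω] {P : Measure Ω} [IsProbabilityMeasure P]

lemma integral_expect_inner_sub_half_norm_sq_le [CompleteSpace E] (hx : IsSubGaussianFamily x)
    {V : Ω → ι → E} {q : Ω → S → ι} (hV : ∀ s, MemLp (fun ω => V ω (q ω s)) 2 P) :
    𝔼 s, ⟪∫ ω, V ω (q ω s) ∂P, x s⟫ - (𝔼 s, ∫ ω, ‖V ω (q ω s)‖ ^ 2 ∂P) / 2 ≤
      Real.log (Fintype.card ι) := by
  have hint (s : S) : Integrable (fun ω => ⟪V ω (q ω s), x s⟫) P :=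
    ((hV s).integrable one_le_two).inner_const _
  have hint_sq (s : S) : Integrable (fun ω => ‖V ω (q ω s)‖ ^ 2 / 2) P :=
    ((hV s).integrable_norm_pow two_ne_zero).div_const 2
  have hinner (s : S) : ⟪∫ ω, V ω (q ω s) ∂P, x s⟫ = ∫ ω, ⟪V ω (q ω s), x s⟫ ∂P := by
    simp_rw [real_inner_comm (x s)]
    exact (integral_inner ((hV s).integrable one_le_two) _).symm
  have hint_sub (s : S) : Integrable (fun ω => ⟪V ω (q ω s), x s⟫ - ‖V ω (q ω s)‖ ^ 2 / 2) P :=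
    (hint s).sub (hint_sq s)
  have hint_expect :
      Integrable (fun ω => 𝔼 s, (⟪V ω (q ω s), x s⟫ - ‖V ω (q ω s)‖ ^ 2 / 2)) P := by
    simp_rw [Fintype.expect_eq_sum_div_card]
    exact (integrable_finsetSum _ fun s _ => hint_sub s).div_const _
  calc 𝔼 s, ⟪∫ ω, V ω (q ω s) ∂P, x s⟫ - (𝔼 s, ∫ ω, ‖V ω (q ω s)‖ ^ 2 ∂P) / 2
      = 𝔼 s, ∫ ω, (⟪V ω (q ω s), x s⟫ - ‖V ω (q ω s)‖ ^ 2 / 2) ∂P := by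
        simp_rw [integral_sub (hint _) (hint_sq _), integral_div, hinner,
          Finset.expect_sub_distrib, Finset.expect_div]
    _ = ∫ ω, 𝔼 s, (⟪V ω (q ω s), x s⟫ - ‖V ω (q ω s)‖ ^ 2 / 2) ∂P := by
        simp_rw [Fintype.expect_eq_sum_div_card]
        rw [integral_div, integral_finsetSum _ fun s _ => hint_sub s]
    _ ≤ ∫ _ω, Real.log (Fintype.card ι) ∂P :=
        integral_mono hint_expect (integrable_const _)
          fun ω => hx.expect_inner_sub_half_norm_sq_le (V ω) (q ω)
    _ = Real.log (Fintype.card ι) := by simp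

lemma sq_expect_inner_integral_le [CompleteSpace E] (hx : IsSubGaussianFamily x)
    {V : Ω → ι → E} {q : Ω → S → ι} (hV : ∀ s, MemLp (fun ω => V ω (q ω s)) 2 P) :
    (𝔼 s, ⟪∫ ω, V ω (q ω s) ∂P, x s⟫) ^ 2 ≤
      2 * Real.log (Fintype.card ι) * 𝔼 s, ∫ ω, ‖V ω (q ω s)‖ ^ 2 ∂P := by
  set m := 𝔼 s, ⟪∫ ω, V ω (q ω s) ∂P, x s⟫
  set M := 𝔼 s, ∫ ω, ‖V ω (q ω s)‖ ^ 2 ∂P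
  have hscaled (t : ℝ) : t * m - t ^ 2 * M / 2 ≤ Real.log (Fintype.card ι) := by
    have h := hx.integral_expect_inner_sub_half_norm_sq_le (V := fun ω o => t • V ω o)
      fun s => (hV s).const_smul t
    simpa only [integral_smul, real_inner_smul_left, norm_smul, mul_pow, Real.norm_eq_abs, sq_abs,
      integral_const_mul, ← Finset.mul_expect] using h
  have hdiscrim := discrim_le_zero (a := M / 2) (b := -m) (c := Real.log (Fintype.card ι))
    fun t => by linarith [hscaled t]
  rw [discrim] at hdiscrim
  linarith

end IsSubGaussianFamily

end SubGaussian

section SignVector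

variable {d : ℕ}

/-- The vector of `ℝ^d` with entries `1` where `σ` is true and `-1` where it is false. These are
the inputs, up to scaling, that are hard to quantize. -/
noncomputable def signVector (σ : Fin d → Bool) : EuclideanSpace ℝ (Fin d) :=
  WithLp.toLp 2 fun i => if σ i then 1 else -1

lemma norm_signVector (σ : Fin d → Bool) : ‖signVector σ‖ = √d := by
  have hentry (i : Fin d) : ‖signVector σ i‖ ^ 2 = 1 := by
    simp only [signVector]
    split_ifs <;> norm_num
  simp_rw [EuclideanSpace.norm_eq, hentry]
  simp

lemma norm_smul_signVector_le {G : ℝ} (hG : 0 ≤ G) (σ : Fin d → Bool) :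
    ‖(G / √d) • signVector σ‖ ≤ G := by
  rw [norm_smul, norm_signVector, Real.norm_of_nonneg (by positivity), div_mul_eq_mul_div]
  exact div_le_of_le_mul₀ (by positivity) hG le_rfl

lemma exp_inner_signVector (v : EuclideanSpace ℝ (Fin d)) (σ : Fin d → Bool) :
    Real.exp ⟪v, signVector σ⟫ = ∏ i, Real.exp (if σ i then v i else -v i) := by
  rw [← Real.exp_sum, PiLp.inner_apply]
  congr! 2 with i
  simp only [signVector]
  split_ifs <;> simp

lemma expect_exp_inner_signVector (v : EuclideanSpace ℝ (Fin d)) :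
    𝔼 σ, Real.exp ⟪v, signVector σ⟫ = ∏ i, Real.cosh (v i) := by
  have hcosh (i : Fin d) :
      ∑ b : Bool, Real.exp (if b then v i else -v i) = 2 * Real.cosh (v i) := by
    simp [Real.cosh_eq, mul_div_cancel₀]
  have hsum : ∑ σ : Fin d → Bool, ∏ i, Real.exp (if σ i then v i else -v i) =
      ∏ i, ∑ b : Bool, Real.exp (if b then v i else -v i) := by
    rw [Finset.prod_univ_sum, Fintype.piFinset_univ]
  simp_rw [Fintype.expect_eq_sum_div_card, exp_inner_signVector, hsum, hcosh]
  simp [Finset.prod_mul_distrib]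

lemma isSubGaussianFamily_signVector : IsSubGaussianFamily (signVector (d := d)) := fun v =>
  calc 𝔼 σ, Real.exp ⟪v, signVector σ⟫
      = ∏ i, Real.cosh (v i) := expect_exp_inner_signVector v
    _ ≤ ∏ i, Real.exp (v i ^ 2 / 2) := by
        gcongr with i
        exact Real.cosh_le_exp_half_sq (v i)
    _ = Real.exp (‖v‖ ^ 2 / 2) := by
        simp [← Real.exp_sum, EuclideanSpace.norm_sq_eq, Finset.sum_div]

end SignVector

lemma integral_norm_sq_eq_integral_norm_sub_sq_add {Ω E : Type*} [MeasurableSpace Ω]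
    {P : Measure Ω} [IsProbabilityMeasure P] [NormedAddCommGroup E] [InnerProductSpace ℝ E]
    [CompleteSpace E] {Y : Ω → E} (hY : MemLp Y 2 P) :
    ∫ ω, ‖Y ω‖ ^ 2 ∂P = ∫ ω, ‖Y ω - ∫ ω', Y ω' ∂P‖ ^ 2 ∂P + ‖∫ ω, Y ω ∂P‖ ^ 2 := by
  have hint := hY.integrable one_le_two
  set y := ∫ ω, Y ω ∂P with hy
  have hint_sub : Integrable (fun ω => Y ω - y) P := hint.sub (integrable_const y)
  have hint_sub_sq : Integrable (fun ω => ‖Y ω - y‖ ^ 2) P :=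
    (hY.sub (memLp_const y)).integrable_norm_pow two_ne_zero
  have hint_cross : Integrable (fun ω => 2 * ⟪y, Y ω - y⟫) P :=
    (hint_sub.const_inner y).const_mul 2
  have hcross : ∫ ω, 2 * ⟪y, Y ω - y⟫ ∂P = 0 := by
    rw [integral_const_mul, integral_inner hint_sub,
      integral_sub hint (integrable_const y), ← hy]
    simp
  have hint_sum : Integrable (fun ω => ‖Y ω - y‖ ^ 2 + 2 * ⟪y, Y ω - y⟫) P :=
    hint_sub_sq.add hint_cross
  have hexpand (ω : Ω) : ‖Y ω‖ ^ 2 = ‖Y ω - y‖ ^ 2 + 2 * ⟪y, Y ω - y⟫ + ‖y‖ ^ 2 := by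
    rw [real_inner_comm, ← norm_add_sq_real, sub_add_cancel]
  simp_rw [hexpand]
  rw [integral_add hint_sum (integrable_const _),
    integral_add hint_sub_sq hint_cross, hcross]
  simp

section Dirac

variable {d : ℕ}

lemma dirac_mem_boundedDistributions {G : ℝ} {z : EuclideanSpace ℝ (Fin d)} (hz : ‖z‖ ≤ G) :
    Measure.dirac z ∈ boundedDistributions d G :=
  ⟨inferInstance, by rwa [ae_dirac_eq]⟩

lemma distMean_dirac (z : EuclideanSpace ℝ (Fin d)) : distMean (Measure.dirac z) = z := by
  simp [distMean]

lemma runLaw_dirac {Ω : Type*} [MeasurableSpace Ω] (P : Measure Ω) [SFinite P] (n : ℕ)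
    (z : EuclideanSpace ℝ (Fin d)) :
    runLaw P n (Measure.dirac z) = P.map fun ω => (ω, fun _ => z) := by
  rw [runLaw, ← Measure.infinitePi_eq_pi, Measure.infinitePi_dirac, Measure.prod_dirac]

end Dirac

namespace SecAggProtocol

variable {Ω : Type*} [MeasurableSpace Ω] {P : Measure Ω} {n d K : ℕ} {A : SecAggProtocol Ω n d K}

lemma mse_dirac [SFinite P] (A : SecAggProtocol Ω n d K) (z : EuclideanSpace ℝ (Fin d)) :
    A.mse P (Measure.dirac z) =
      ∫⁻ ω, ENNReal.ofReal (‖A.output ω (fun _ => z) - z‖ ^ 2) ∂P := by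
  rw [mse, runLaw_dirac, distMean_dirac, (measurableEmbedding_prod_mk_right _).lintegral_map]

lemma exists_bits_le_of_probBitsLE_pos {D : Measure (EuclideanSpace ℝ (Fin d))} {b : ℝ}
    (h : 0 < A.probBitsLE P D b) : ∃ ω z, A.bits ω z ≤ b := by
  obtain ⟨x, hx⟩ := nonempty_of_measureReal_ne_zero h.ne'
  exact ⟨x.1, x.2, hx⟩

lemma output_eq_of_zero_rounds (A : SecAggProtocol Ω n d 0) (ω : Ω)
    (z z' : Fin n → EuclideanSpace ℝ (Fin d)) : A.output ω z = A.output ω z' := by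
  cases A
  rfl

lemma bits_eq_zero_of_zero_rounds (A : SecAggProtocol Ω n d 0) (ω : Ω)
    (z : Fin n → EuclideanSpace ℝ (Fin d)) : A.bits ω z = 0 := by
  cases A
  rfl

lemma exists_quantizer_of_lt_two (A : SecAggProtocol Ω n d K) (hK : K < 2) :
    ∃ (O : Type) (_ : Fintype O) (V : Ω → O → EuclideanSpace ℝ (Fin d))
      (q : Ω → (Fin n → EuclideanSpace ℝ (Fin d)) → O),
      (∀ ω z, A.output ω z = V ω (q ω z)) ∧
        ∀ ω z, A.bits ω z = Real.logb 2 (Fintype.card O) := by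
  cases A with
  | decode U _ => exact ⟨Unit, inferInstance, fun ω _ => U ω, fun _ _ => (), by simp [output, bits]⟩
  | @round K O _ _ enc _ next =>
    obtain rfl : K = 0 := by omega
    refine ⟨O, inferInstance, fun ω o => (next o).output ω 0, fun ω z => ∑ i, enc i ω (z i),
      fun ω z => ?_, fun ω z => ?_⟩
    · rw [output, output_eq_of_zero_rounds]
    · rw [bits, bits_eq_zero_of_zero_rounds, add_zero]

lemma output_eq_of_bits_le_zero (hK : K < 2) {ω₀ : Ω} {z₀ : Fin n → EuclideanSpace ℝ (Fin d)}
    (h : A.bits ω₀ z₀ ≤ 0) (ω : Ω) (z z' : Fin n → EuclideanSpace ℝ (Fin d)) :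
    A.output ω z = A.output ω z' := by
  obtain ⟨O, _, V, q, hout, hbits⟩ := A.exists_quantizer_of_lt_two hK
  have hcard : Fintype.card O ≤ 1 := by
    by_contra! hO
    exact (Real.logb_pos one_lt_two (by exact_mod_cast hO)).not_ge (hbits ω₀ z₀ ▸ h)
  have := Fintype.card_le_one_iff_subsingleton.1 hcard
  rw [hout, hout, Subsingleton.elim (q ω z) (q ω z')]

namespace Unbiased

variable [IsProbabilityMeasure P] {G : ℝ} {z : EuclideanSpace ℝ (Fin d)}

lemma integrable_output_const (hA : A.Unbiased P G) (hz : ‖z‖ ≤ G) :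
    Integrable (fun ω => A.output ω fun _ => z) P := by
  have h := (hA _ (dirac_mem_boundedDistributions hz)).1
  rwa [runLaw_dirac, (measurableEmbedding_prod_mk_right _).integrable_map_iff] at h

lemma integral_output_const (hA : A.Unbiased P G) (hz : ‖z‖ ≤ G) :
    ∫ ω, A.output ω (fun _ => z) ∂P = z := by
  have h := (hA _ (dirac_mem_boundedDistributions hz)).2
  rwa [runLaw_dirac, distMean_dirac, (measurableEmbedding_prod_mk_right _).integral_map] at h

lemma exists_output_ne [NeZero d] (hA : A.Unbiased P G) (hG : 0 < G) :
    ∃ ω z z', A.output ω z ≠ A.output ω z' := by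
  by_contra! hconst
  obtain ⟨v, hv⟩ := exists_norm_eq (EuclideanSpace ℝ (Fin d)) hG.le
  have hv0 : v = 0 := by
    rw [← hA.integral_output_const hv.le,
      ← hA.integral_output_const (z := (0 : EuclideanSpace ℝ (Fin d))) (by simpa using hG.le)]
    simp_rw [hconst _ (fun _ => v) fun _ => 0]
  exact hG.ne (by rw [← hv, hv0, norm_zero])

lemma memLp_output_const (hA : A.Unbiased P G) (hz : ‖z‖ ≤ G)
    (hmse : A.mse P (Measure.dirac z) ≠ ∞) : MemLp (fun ω => A.output ω fun _ => z) 2 P := by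
  have hmeas : AEStronglyMeasurable (fun ω => A.output ω (fun _ => z) - z) P :=
    (hA.integrable_output_const hz).aestronglyMeasurable.sub aestronglyMeasurable_const
  have hsub : MemLp (fun ω => A.output ω (fun _ => z) - z) 2 P := by
    rw [memLp_two_iff_integrable_sq_norm hmeas, ← lintegral_ofReal_ne_top_iff_integrable
      (by fun_prop) (.of_forall fun _ => by positivity), ← mse_dirac]
    exact hmse
  simpa only [Pi.add_def, sub_add_cancel] using hsub.add (memLp_const z)

lemma integral_norm_sq_output_const_le (hA : A.Unbiased P G) (hz : ‖z‖ ≤ G) {E : ℝ} (hE : 0 ≤ E)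
    (hmse : A.mse P (Measure.dirac z) ≤ ENNReal.ofReal E) :
    ∫ ω, ‖A.output ω fun _ => z‖ ^ 2 ∂P ≤ E + G ^ 2 := by
  have hmem := hA.memLp_output_const hz (hmse.trans_lt ENNReal.ofReal_lt_top).ne
  have hvar : ∫ ω, ‖A.output ω (fun _ => z) - z‖ ^ 2 ∂P ≤ E := by
    rw [integral_eq_lintegral_of_nonneg_ae (.of_forall fun _ => by positivity)
      (by have := hmem.1; fun_prop), ← mse_dirac]
    exact ENNReal.toReal_le_of_le_ofReal hE hmse
  rw [integral_norm_sq_eq_integral_norm_sub_sq_add hmem, hA.integral_output_const hz]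
  gcongr

lemma sq_mul_le_of_lt_two (hA : A.Unbiased P G) (hG : 0 ≤ G) (hK : K < 2) {E : ℝ} (hE : 0 ≤ E)
    (hmse : ∀ z, ‖z‖ ≤ G → A.mse P (Measure.dirac z) ≤ ENNReal.ofReal E) {b : ℝ} {ω₀ : Ω}
    {z₀ : Fin n → EuclideanSpace ℝ (Fin d)} (hb : A.bits ω₀ z₀ ≤ b) :
    G ^ 2 * d ≤ 2 * b * (E + G ^ 2) := by
  obtain ⟨O, _, V, q, hout, hbits⟩ := A.exists_quantizer_of_lt_two hK
  set x : (Fin d → Bool) → EuclideanSpace ℝ (Fin d) := fun σ => (G / √d) • signVector σ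
  have hx (σ : Fin d → Bool) : ‖x σ‖ ≤ G := norm_smul_signVector_le hG σ
  have hmem (σ : Fin d → Bool) : MemLp (fun ω => V ω (q ω fun _ => x σ)) 2 P := by
    simpa only [hout] using
      hA.memLp_output_const (hx σ) ((hmse _ (hx σ)).trans_lt ENNReal.ofReal_lt_top).ne
  have hcorrelation : 𝔼 σ, ⟪∫ ω, V ω (q ω fun _ => x σ) ∂P, signVector σ⟫ = G * √d := by
    simp_rw [← hout, hA.integral_output_const (hx _), x, real_inner_smul_left,
      real_inner_self_eq_norm_sq, norm_signVector, Fintype.expect_const,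
      Real.sq_sqrt d.cast_nonneg, div_mul_eq_mul_div, mul_div_assoc, Real.div_sqrt]
  have hmoment : 𝔼 σ, ∫ ω, ‖V ω (q ω fun _ => x σ)‖ ^ 2 ∂P ≤ E + G ^ 2 := by
    refine Finset.expect_le Finset.univ_nonempty fun σ _ => ?_
    simpa only [hout] using hA.integral_norm_sq_output_const_le (hx σ) hE (hmse _ (hx σ))
  have hlog : Real.log (Fintype.card O) ≤ b :=
    calc Real.log (Fintype.card O)
        ≤ Real.logb 2 (Fintype.card O) :=
          le_div_self (Real.log_natCast_nonneg _) (Real.log_pos one_lt_two)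
            (Real.log_two_lt_d9.le.trans (by norm_num))
      _ ≤ b := hbits ω₀ z₀ ▸ hb
  calc G ^ 2 * d = (G * √d) ^ 2 := by rw [mul_pow, Real.sq_sqrt d.cast_nonneg]
    _ ≤ 2 * Real.log (Fintype.card O) * 𝔼 σ, ∫ ω, ‖V ω (q ω fun _ => x σ)‖ ^ 2 ∂P :=
        hcorrelation ▸ isSubGaussianFamily_signVector.sq_expect_inner_integral_le hmem
    _ ≤ 2 * b * (E + G ^ 2) := by
        have : 0 ≤ b := (Real.log_natCast_nonneg _).trans hlog
        gcongr

end Unbiased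

end SecAggProtocol

section Rates

lemma commBudget_zero (d n : ℕ) (ε δ : ℝ) : commBudget d n ε δ 0 = 0 := by
  simp [commBudget]

variable {d n : ℕ} {ε δ : ℝ}

lemma errorRate_nonneg (d n : ℕ) (G ε : ℝ) (hδ : 0 < δ) (hδ1 : δ ≤ 1) :
    0 ≤ errorRate d n G ε δ := by
  have : 0 ≤ Real.log (1 / δ) := Real.log_nonneg ((one_le_div hδ).2 hδ1)
  unfold errorRate
  positivity

lemma errorRate_add_sq_mul_commBudget_le (hn : 1 ≤ n) (G : ℝ) (hε : 0 < ε) (hδ : 0 < δ)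
    (hδ1 : δ < 1) :
    (errorRate d n G ε δ + G ^ 2) * commBudget d n ε δ 1 ≤ 3 * (G ^ 2 * d) := by
  have hL : 0 < Real.log (1 / δ) := Real.log_pos ((one_lt_div hδ).2 hδ1)
  have hn1 : (1 : ℝ) ≤ n := by exact_mod_cast hn
  have hB0 : 0 ≤ commBudget d n ε δ 1 := by
    unfold commBudget
    positivity
  have hBd : commBudget d n ε δ 1 ≤ d := min_le_left _ _
  have hBε : commBudget d n ε δ 1 ≤ n ^ 2 * ε ^ 2 / Real.log (1 / δ) := by
    simp [commBudget]
  calc (errorRate d n G ε δ + G ^ 2) * commBudget d n ε δ 1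
      = G ^ 2 / n * commBudget d n ε δ 1
        + G ^ 2 * d * Real.log (1 / δ) / (n ^ 2 * ε ^ 2) * commBudget d n ε δ 1
        + G ^ 2 * commBudget d n ε δ 1 := by rw [errorRate]; ring
    _ ≤ G ^ 2 * d
        + G ^ 2 * d * Real.log (1 / δ) / (n ^ 2 * ε ^ 2) * (n ^ 2 * ε ^ 2 / Real.log (1 / δ))
        + G ^ 2 * d := by
        gcongr
        exact div_le_self (sq_nonneg G) hn1
    _ = 3 * (G ^ 2 * d) := by field_simp; ring

end Rates

lemma SecAggProtocol.Unbiased.commBudget_one_le_of_lt_two {Ω : Type*} [MeasurableSpace Ω]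
    {P : Measure Ω} [IsProbabilityMeasure P] {K d n : ℕ} {A : SecAggProtocol Ω n d K} {G : ℝ}
    (hA : A.Unbiased P G) (hK : K < 2) (hn : 1 ≤ n) (hG : 0 < G) {ε δ : ℝ} (hε : 0 < ε)
    (hδ : 0 < δ) (hδ1 : δ < 1) {C : ℝ} (hC : 1 ≤ C)
    (hmse : ∀ z, ‖z‖ ≤ G →
      A.mse P (Measure.dirac z) ≤ ENNReal.ofReal (C * errorRate d n G ε δ))
    {b : ℝ} {ω₀ : Ω} {z₀ : Fin n → EuclideanSpace ℝ (Fin d)} (hb : A.bits ω₀ z₀ ≤ b) :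
    commBudget d n ε δ 1 ≤ 6 * C * b := by
  set α := errorRate d n G ε δ
  have hα : 0 ≤ α := errorRate_nonneg d n G ε hδ hδ1.le
  have hquant : G ^ 2 * d ≤ 2 * b * (C * α + G ^ 2) :=
    hA.sq_mul_le_of_lt_two hG.le hK (by positivity) hmse hb
  have hb0 : 0 ≤ 2 * b :=
    nonneg_of_mul_nonneg_left (le_trans (by positivity) hquant) (by positivity)
  refine le_of_mul_le_mul_left ?_ (by positivity : 0 < α + G ^ 2)
  calc (α + G ^ 2) * commBudget d n ε δ 1
      ≤ 3 * (G ^ 2 * d) := errorRate_add_sq_mul_commBudget_le hn G hε hδ hδ1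
    _ ≤ 3 * (2 * b * (C * α + G ^ 2)) := by gcongr
    _ ≤ 3 * (2 * b * (C * α + C * G ^ 2)) := by
        gcongr
        exact le_mul_of_one_le_left (sq_nonneg G) hC
    _ = (α + G ^ 2) * (6 * C * b) := by ring

theorem mainTheorem3_general :
    (∀ (K d n : ℕ) (G : ℝ), 1 ≤ d → 0 < G →
      ∀ (Ω : Type u) [MeasurableSpace Ω] (P : Measure Ω) [IsProbabilityMeasure P]
        (A : SecAggProtocol Ω n d K) (D : Measure (EuclideanSpace ℝ (Fin d))),
        A.Unbiased P G → 0 < A.probBitsLE P D 0 → 2 ≤ K) ∧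
    (∃ c : ℝ, 0 < c ∧
      ∀ (K d n : ℕ) (G ε δ : ℝ), 1 ≤ n → 0 < G → 0 < ε → 0 < δ → δ < 1 →
      ∀ (Ω : Type u) [MeasurableSpace Ω] (P : Measure Ω) [IsProbabilityMeasure P]
        (A : SecAggProtocol Ω n d K) (D : Measure (EuclideanSpace ℝ (Fin d))) (C₁ s : ℝ),
        1 ≤ C₁ →
        s < c / C₁ * commBudget d n ε δ 1 →
        A.Unbiased P G →
        (∀ z, ‖z‖ ≤ G →
          A.mse P (Measure.dirac z) ≤ ENNReal.ofReal (C₁ * errorRate d n G ε δ)) →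
        0 < A.probBitsLE P D s →
        2 ≤ K) := by
  refine ⟨?_, 1 / 6, by norm_num, ?_⟩
  · intro K d n G hd hG Ω _ P _ A D hA hbits
    by_contra! hK
    have : NeZero d := ⟨by omega⟩
    obtain ⟨ω₀, z₀, hb⟩ := SecAggProtocol.exists_bits_le_of_probBitsLE_pos hbits
    obtain ⟨ω, z, z', hne⟩ := hA.exists_output_ne hG
    exact hne (SecAggProtocol.output_eq_of_bits_le_zero hK hb ω z z')
  · intro K d n G ε δ hn hG hε hδ hδ1 Ω _ P _ A D C₁ s hC₁ hs hA hmse hbits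
    by_contra! hK
    obtain ⟨ω₀, z₀, hb⟩ := SecAggProtocol.exists_bits_le_of_probBitsLE_pos hbits
    have hB := hA.commBudget_one_le_of_lt_two hK hn hG hε hδ hδ1 hC₁ hmse hb
    rw [div_mul_eq_mul_div, lt_div_iff₀ (by linarith)] at hs
    linarith

/-- First part: a `K`-round unbiased protocol with error `O(min (‖μ‖², errorRate))` and, with
probability `> 1/n`, communication `O(commBudget ‖μ‖)`, pointwise for all bounded distributions,
has `K ≥ 2`.  Second part, under weaker hypotheses that protocols with two rounds can meet: the
error is only asked to be `O(errorRate)`, and up to `s` additional bits are allowed, where `s` is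
less than a fixed fraction of the worst-case budget (the one for `‖μ‖ = G`). -/
theorem mainTheorem3 :
    (∀ (K d n : ℕ) (G ε δ : ℝ), 1 ≤ d → 2 ≤ n → 0 < G → 0 < ε → 0 < δ →
      ∀ (Ω : Type u) [MeasurableSpace Ω] (P : Measure Ω) [IsProbabilityMeasure P]
        (A : SecAggProtocol Ω n d K) (C₁ C₂ : ℝ),
        A.Unbiased P G →
        (∀ D ∈ boundedDistributions d G,
          A.mse P D ≤
            ENNReal.ofReal (C₁ * min (‖distMean D‖ ^ 2) (errorRate d n G ε δ))) →
        (∀ D ∈ boundedDistributions d G,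
          1 / (n : ℝ) < A.probBitsLE P D (C₂ * commBudget d n ε δ ‖distMean D‖)) →
        2 ≤ K) ∧
    (∃ c : ℝ, 0 < c ∧
      ∀ (K d n : ℕ) (G ε δ : ℝ), 1 ≤ d → 2 ≤ n → 0 < G → 0 < ε → 0 < δ → δ < 1 →
      ∀ (Ω : Type u) [MeasurableSpace Ω] (P : Measure Ω) [IsProbabilityMeasure P]
        (A : SecAggProtocol Ω n d K) (C₁ C₂ s : ℝ),
        1 ≤ C₁ →
        s < c / C₁ * commBudget d n ε δ 1 →
        A.Unbiased P G →
        (∀ D ∈ boundedDistributions d G,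
          A.mse P D ≤ ENNReal.ofReal (C₁ * errorRate d n G ε δ)) →
        (∀ D ∈ boundedDistributions d G,
          1 / (n : ℝ) < A.probBitsLE P D (C₂ * commBudget d n ε δ (‖distMean D‖ / G) + s)) →
        2 ≤ K) := by
  obtain ⟨hzero, c, hc, hrate⟩ := mainTheorem3_general.{u}
  refine ⟨fun K d n G ε δ hd _ hG _ _ Ω _ P _ A C₁ C₂ hA _ hbits => ?_, c, hc,
    fun K d n G ε δ _ hn hG hε hδ hδ1 Ω _ P _ A C₁ C₂ s hC₁ hs hA hmse hbits => ?_⟩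
  all_goals
    have hbits₀ := (by positivity : (0 : ℝ) ≤ 1 / n).trans_lt
      (hbits _ (dirac_mem_boundedDistributions (z := 0) (by simpa using hG.le)))
  · refine hzero K d n G hd hG Ω P A (.dirac 0) hA ?_
    simpa [distMean_dirac, commBudget_zero] using hbits₀
  · refine hrate K d n G ε δ (by omega) hG hε hδ hδ1 Ω P A (.dirac 0) C₁ s hC₁ hs hA
      (fun z hz => hmse _ (dirac_mem_boundedDistributions hz)) ?_
    simpa [distMean_dirac, commBudget_zero] using hbits₀
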